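/- Let $(\mathcal S,\mathcal E,\lambda)$ be a weighted directed graph with countable node set $\mathcal S\subset\mathbb R^d$, edge set $\mathcal E\subset\mathcal S\times\mathcal S$ and edge weights $\lambda_e>0$. Assume that it is strongly connected, has no self edges $(y,y)$, and is invariant under integer translations: for every $n\in\mathbb Z^d$, $x\in\mathcal S$ implies $x+n\in\mathcal S$, and $(x,y)\in\mathcal E$ implies $(x+n,y+n)\in\mathcal E$ and $\lambda(x+n,y+n)=\lambda(x,y)$. Let $\overline{\mathcal S}=\mathcal S\cap[0,1)^d$ be the set of nodes modulo integer translations, $\Pi:\mathcal S\to\overline{\mathcal S}$ the reduction modulo $\mathbb Z^d$, and $\overline{\mathcal E}$ the set of edges modulo integer translations, identified with the edges that originate in $\overline{\mathcal S}$; assume that $\overline{\mathcal S}$ and $\overline{\mathcal E}$ are finite. For $e=(x,y)\in\mathcal E$ write $\partial_-e=x$ and $\nu_e=y-x$. Let $\{R_e\}_{e\in\overline{\mathcal E}}$ be independent unit-rate Poisson processes on a probability space, and let $Z$ be the continuous-time random walk on the graph started from a node $z_0\in\mathcal S$ with jump rates $\lambda$, given by the random time change representation: $Z$ is right-continuous and,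 almost surely, for all $t\ge0$, $$Z(t)=z_0+\sum_{e\in\overline{\mathcal E}}\nu_e\,R_e\Big(\lambda_e\int_0^t 1_{\{\partial_-e\}}(Y(s))\,ds\Big),\qquad Y(s)=\Pi Z(s).$$ For $x\ne y$ in $\overline{\mathcal S}$ let $L(x,y)$ be the sum of $\lambda(x,z)$ over the edges $(x,z)\in\mathcal E$ with $\Pi(z)=y$, and let $L(x,x)=-\sum_{y\ne x}L(x,y)$. Let $\pi$ be the stationary probability measure of $Y$: $\pi\ge0$, $\sum_{y\in\overline{\mathcal S}}\pi(y)=1$ and $L^T\pi=0$. Put $$\rho(y)=\sum_{e\in\mathcal E,\ \partial_-e=y}\nu_e\lambda_e,\qquad \bar U=\sum_{y\in\overline{\mathcal S}}\rho(y)\pi(y).$$ Then for all fixed $0<t_0<T<\infty$, almost surely, $$\lim_{\varepsilon\to0^+}\ \sup_{t\in[t_0,T]}\big|\varepsilon^2Z(t/\varepsilon^2)-t\,\bar U\big|=0.$$ -/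

import Mathlib

open MeasureTheory ProbabilityTheory Filter Topology
open scoped NNReal ENNReal

noncomputable section

/-- The Euclidean space in which the graphs are embedded. -/
abbrev Space (d : ℕ) : Type := EuclideanSpace ℝ (Fin d)

/-- An integer vector, viewed as a vector of `ℝ^d`. -/
def intVec {d : ℕ} (n : Fin d → ℤ) : Space d := WithLp.toLp 2 (fun i => (n i : ℝ))

/-- Coordinatewise reduction modulo `1`. It sends a node to the representative in `[0,1)^d` of its
class modulo integer translations. -/
def projCell {d : ℕ} (x : Space d) : Space d := WithLp.toLp 2 (fun i => Int.fract (x i))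

/-- The half-open unit cell `[0,1)^d`. -/
def unitCell (d : ℕ) : Set (Space d) := {x | ∀ i, x i ∈ Set.Ico (0 : ℝ) 1}

/-- A periodic weighted directed graph embedded in `ℝ^d`: strongly connected, without self edges,
invariant under integer translations, with finitely many nodes and edges modulo translations.
The rate function is total; only its values on edges matter. -/
structure PeriodicGraph (d : ℕ) where
  nodes : Set (Space d)
  edges : Set (Space d × Space d)
  rate : Space d × Space d → ℝ
  edges_subset : edges ⊆ nodes ×ˢ nodes
  rate_pos : ∀ e ∈ edges, 0 < rate e
  nodes_countable : nodes.Countable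
  no_self_edge : ∀ x, (x, x) ∉ edges
  strongly_connected : ∀ x ∈ nodes, ∀ y ∈ nodes,
    Relation.ReflTransGen (fun a b => (a, b) ∈ edges) x y
  nodes_translate : ∀ (n : Fin d → ℤ), ∀ x ∈ nodes, x + intVec n ∈ nodes
  edges_translate : ∀ (n : Fin d → ℤ) (x y : Space d), (x, y) ∈ edges →
    (x + intVec n, y + intVec n) ∈ edges
  rate_translate : ∀ (n : Fin d → ℤ) (x y : Space d), (x, y) ∈ edges →
    rate (x + intVec n, y + intVec n) = rate (x, y)
  finite_cell_nodes : (nodes ∩ unitCell d).Finite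
  finite_cell_edges : {e | e ∈ edges ∧ e.1 ∈ unitCell d}.Finite

namespace PeriodicGraph

variable {d : ℕ} (G : PeriodicGraph d)

/-- The nodes modulo integer translations, identified with the nodes in the unit cell. -/
def cellNodes : Finset (Space d) := G.finite_cell_nodes.toFinset

/-- The edges modulo integer translations, identified with the edges that originate in the
unit cell. -/
def cellEdges : Finset (Space d × Space d) := G.finite_cell_edges.toFinset

open Classical in
/-- The total rate `λ̄(x, y)` of the edges which originate in `x` and terminate in a translate
of `y`. -/
def cellRate (x y : G.cellNodes) : ℝ :=
  ∑ e ∈ G.cellEdges with e.1 = x.1 ∧ projCell e.2 = y.1, G.rate e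

open Classical in
/-- The rate matrix `L` of the walk projected on the unit cell. -/
def rateMatrix : Matrix G.cellNodes G.cellNodes ℝ := fun x y =>
  if x = y then -∑ z ∈ Finset.univ.erase x, G.cellRate x z else G.cellRate x y

/-- `π` is a stationary probability measure of the projected walk: a probability vector in the
null space of the transposed rate matrix. -/
structure IsStationary (π : G.cellNodes → ℝ) : Prop where
  nonneg : ∀ y, 0 ≤ π y
  sum_eq_one : ∑ y, π y = 1
  transpose_mulVec_eq_zero : Matrix.mulVec G.rateMatrix.transpose π = 0

open Classical in
/-- The drift field `ρ(y)`: the sum of `λ_e ν_e` over the edges `e` that originate in `y`, where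
`ν_e` is the jump size. -/
def drift (y : G.cellNodes) : Space d :=
  ∑ e ∈ G.cellEdges with e.1 = y.1, G.rate e • (e.2 - e.1)

/-- The long run drift rate `Ū = ∑ y, π(y) ρ(y)`. -/
def longRunDrift (π : G.cellNodes → ℝ) : Space d := ∑ y, π y • G.drift y

end PeriodicGraph

/-- A unit-rate Poisson process: a counting process with nondecreasing right-continuous paths
started from `0`, with independent increments, the increment over `[s, t]` being Poisson distributed
with parameter `t - s`. -/
structure IsUnitPoissonProcess {Ω : Type*} [MeasurableSpace Ω] (P : Measure Ω)
    (R : ℝ≥0 → Ω → ℕ) : Prop where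
  measurable : ∀ t, Measurable (R t)
  zero : ∀ᵐ ω ∂P, R 0 ω = 0
  mono : ∀ᵐ ω ∂P, Monotone (fun t => R t ω)
  right_continuous : ∀ᵐ ω ∂P, ∀ t, ContinuousWithinAt (fun s => R s ω) (Set.Ici t) t
  indep_increments : HasIndepIncrements R P
  increment_law : ∀ s t, s ≤ t → HasLaw (fun ω => R t ω - R s ω) (poissonMeasure (t - s)) P

namespace PeriodicGraph

variable {d : ℕ} (G : PeriodicGraph d) {Ω : Type*}

open Classical in
/-- The internal time `λ_e ∫₀ᵗ 1{Y(s) = ∂₋e} ds` of the edge `e`, where `Y` is the projection of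
the walk `Z` on the unit cell. -/
def edgeClock (Z : ℝ → Ω → Space d) (e : G.cellEdges) (t : ℝ) (ω : Ω) : ℝ :=
  G.rate e.1 * ∫ s in (0 : ℝ)..t, if projCell (Z s ω) = e.1.1 then (1 : ℝ) else 0

/-- `Z` is the continuous-time random walk on the graph `G` started from `z₀` and driven by the
Poisson processes `R e`, that is, the right-continuous process with
`Z(t) = z₀ + ∑ e, ν_e R_e(λ_e ∫₀ᵗ 1{Y(s) = ∂₋e} ds)` for all `t ≥ 0`, where `e` runs over the edges
modulo translations. -/
structure IsRandomWalk [MeasurableSpace Ω] (P : Measure Ω) (R : G.cellEdges → ℝ≥0 → Ω → ℕ)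
    (z₀ : Space d) (Z : ℝ → Ω → Space d) : Prop where
  measurable : ∀ t, 0 ≤ t → Measurable (Z t)
  right_continuous : ∀ᵐ ω ∂P, ∀ t, 0 ≤ t →
    ContinuousWithinAt (fun s => Z s ω) (Set.Ici t) t
  time_change : ∀ᵐ ω ∂P, ∀ t, 0 ≤ t →
    Z t ω = z₀ + ∑ e : G.cellEdges,
      (R e (G.edgeClock Z e t ω).toNNReal ω : ℝ) • (e.1.2 - e.1.1)

end PeriodicGraph

end

/-!
The theorem holds path by path, once two almost sure properties of the driving Poisson processes are
known: `R_e(u) / u → 1`, which is the strong law of large numbers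
(`IsUnitPoissonProcess.ae_abs_sub_le`), and the absence of double or simultaneous jumps when the
processes run at constant speeds, which is a union bound over a fine partition
(`IsUnitPoissonProcess.ae_sum_le_sum_add_one`). A path with these properties satisfies
`PeriodicGraph.IsDrivenPath`.

Let `N_e(t)` be the number of jumps along the edge `e` up to time `t`, and `T_x(t)` the time spent
at `x` by the projected walk. Since jumps occur one at a time, and along edges that originate at the
current position, the walk stays in the set of nodes and, for every function `f` on the cell,
`f(Y(t)) - f(Y(0)) = ∑ e, N_e(t) (f(Π ∂₊e) - f(∂₋e))`
(`PeriodicGraph.IsDrivenPath.mem_nodes_and_balance`). The left-hand side is bounded and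
`N_e(t) = λ_e T_{∂₋e}(t) + o(t)`, so that `∑ x, (T_x(t) / t) (L f)(x) → 0` for every `f`.

The kernel of `L` consists of the constants by the maximum principle and strong connectivity, so the
range of `L` is the hyperplane orthogonal to `π` (`PeriodicGraph.exists_mulVec_eq`). Solving
`L f = 1_y - π(y)` gives `T_y(t) / t → π(y)`. Hence `N_e(t) / t → λ_e π(∂₋e)` and `Z(t) / t → Ū`,
and the uniform statement follows by rescaling.
-/

open MeasureTheory ProbabilityTheory Filter Topology
open scoped NNReal ENNReal

noncomputable section

/-! ### Poisson processes -/

lemma poissonMeasure_one_le (r : ℝ≥0) : poissonMeasure r {n | 1 ≤ n} ≤ ENNReal.ofReal r := by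
  have h : {n : ℕ | 1 ≤ n} = {0}ᶜ := by ext n; simp; omega
  rw [h, ← ofReal_measureReal, probReal_compl_eq_one_sub (by simp), poissonMeasure_real_singleton]
  apply ENNReal.ofReal_le_ofReal
  have := Real.add_one_le_exp (-(r : ℝ))
  simp
  linarith

lemma poissonMeasure_two_le (r : ℝ≥0) :
    poissonMeasure r {n | 2 ≤ n} ≤ ENNReal.ofReal ((r : ℝ) ^ 2) := by
  have h : {n : ℕ | 2 ≤ n} = ({0} ∪ {1})ᶜ := by ext n; simp; omega
  rw [h, ← ofReal_measureReal, probReal_compl_eq_one_sub (by simp),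
    measureReal_union (by simp) (by simp), poissonMeasure_real_singleton,
    poissonMeasure_real_singleton]
  apply ENNReal.ofReal_le_ofReal
  have := Real.add_one_le_exp (-(r : ℝ))
  have hr : (0 : ℝ) ≤ r := r.2
  simp
  nlinarith

lemma hasSum_id_poisson (r : ℝ≥0) :
    HasSum (fun n : ℕ => Real.exp (-r) * (r : ℝ) ^ n / (n.factorial : ℝ) * (n : ℝ)) r := by
  rw [← hasSum_nat_add_iff' 1]
  have h := (hasSum_one_poissonMeasure r).mul_left (r : ℝ)
  simp only [Finset.range_one, Finset.sum_singleton, Nat.cast_zero, mul_zero, sub_zero]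
  rw [mul_one] at h
  refine h.congr_fun (fun n => ?_)
  rw [Nat.factorial_succ]
  push_cast
  field_simp
  ring

lemma integrable_cast_poissonMeasure (r : ℝ≥0) :
    Integrable (fun n : ℕ => (n : ℝ)) (poissonMeasure r) := by
  rw [integrable_poissonMeasure_iff]
  simpa using (hasSum_id_poisson r).summable

lemma integral_cast_poissonMeasure (r : ℝ≥0) :
    ∫ n : ℕ, (n : ℝ) ∂(poissonMeasure r) = r := by
  rw [integral_poissonMeasure]
  simpa [smul_eq_mul] using (hasSum_id_poisson r).tsum_eq

/-- If a monotone `a : ℝ≥0 → ℕ` satisfies `a n ~ n` along the integers, then `a u - u` is sublinear. -/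
lemma exists_abs_sub_le_of_tendsto_nat {a : ℝ≥0 → ℕ} (ha : Monotone a)
    (h : Tendsto (fun n : ℕ => (a n : ℝ) / n) atTop (𝓝 1)) {δ : ℝ} (hδ : 0 < δ) :
    ∃ C : ℝ, ∀ u : ℝ≥0, |(a u : ℝ) - u| ≤ δ * u + C := by
  obtain ⟨M, hM⟩ := Metric.tendsto_atTop.1 h δ hδ
  have key : ∀ n : ℕ, |(a n : ℝ) - n| ≤ δ * n + (a M + M) := by
    intro n
    rcases le_total n M with hn | hn
    · have h1 : (a n : ℝ) ≤ a M := by exact_mod_cast ha (by exact_mod_cast hn)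
      have h2 : (n : ℝ) ≤ M := by exact_mod_cast hn
      have h3 : (0 : ℝ) ≤ a n := by positivity
      have h4 : 0 ≤ δ * n := by positivity
      rw [abs_le]; constructor <;> linarith [Nat.cast_nonneg (α := ℝ) n]
    · have := hM n hn
      rcases Nat.eq_zero_or_pos n with h0 | h0
      · subst h0
        obtain rfl : M = 0 := by omega
        simp
      · have hn' : (0 : ℝ) < n := by exact_mod_cast h0
        rw [Real.dist_eq] at this
        have e : (a n : ℝ) - n = ((a n : ℝ) / n - 1) * n := by field_simp
        rw [e, abs_mul, abs_of_pos hn']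
        have : 0 ≤ (a M : ℝ) + M := by positivity
        nlinarith
  refine ⟨δ + (a M + M) + 1, fun u => ?_⟩
  have hl := key ⌊u⌋₊
  have hu := key (⌊u⌋₊ + 1)
  have f1 : ((⌊u⌋₊ : ℝ≥0)) ≤ u := Nat.floor_le (zero_le)
  have f2 : u ≤ ((⌊u⌋₊ + 1 : ℕ) : ℝ≥0) := by push_cast; exact (Nat.lt_floor_add_one u).le
  have g1 : (a ⌊u⌋₊ : ℝ) ≤ a u := by exact_mod_cast ha f1
  have g2 : (a u : ℝ) ≤ a ((⌊u⌋₊ + 1 : ℕ) : ℝ≥0) := by exact_mod_cast ha f2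
  have f1' : (⌊u⌋₊ : ℝ) ≤ u := by exact_mod_cast f1
  have f2' : (u : ℝ) ≤ ⌊u⌋₊ + 1 := by exact_mod_cast f2
  push_cast at hu g2
  rw [abs_le] at *
  constructor <;> nlinarith

namespace IsUnitPoissonProcess

variable {Ω : Type*} [MeasurableSpace Ω] {P : Measure Ω}

lemma tendsto_nat_div {R : ℝ≥0 → Ω → ℕ} (hR : IsUnitPoissonProcess P R) :
    ∀ᵐ ω ∂P, Tendsto (fun n : ℕ => (R n ω : ℝ) / n) atTop (𝓝 1) := by
  have hlaw : ∀ i : ℕ, HasLaw (fun ω => R ((i + 1 : ℕ) : ℝ≥0) ω - R (i : ℝ≥0) ω)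
      (poissonMeasure 1) P := by
    intro i
    have := hR.increment_law (i : ℝ≥0) ((i + 1 : ℕ) : ℝ≥0) (by push_cast; exact le_self_add)
    simpa using this
  have hind := hR.indep_increments.nat (t := fun n : ℕ => (n : ℝ≥0)) Nat.mono_cast
  have hm : Measurable (fun n : ℕ => (n : ℝ)) := measurable_from_top
  have hint := (integrable_cast_poissonMeasure 1)
  have h := strong_law_ae_real (μ := P)
    (fun i ω => ((R ((i + 1 : ℕ) : ℝ≥0) ω - R (i : ℝ≥0) ω : ℕ) : ℝ)) ?_ ?_ ?_
  · have hE : P[fun ω => ((R ((0 + 1 : ℕ) : ℝ≥0) ω - R ((0 : ℕ) : ℝ≥0) ω : ℕ) : ℝ)] = 1 := by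
      have := (hlaw 0).integral_comp (f := fun n : ℕ => (n : ℝ)) hm.aestronglyMeasurable
      rw [integral_cast_poissonMeasure] at this
      simpa [Function.comp_def] using this
    rw [hE] at h
    filter_upwards [h, hR.mono, hR.zero] with ω hω hmono h0
    refine hω.congr (fun n => ?_)
    congr 1
    have : ∀ i : ℕ, ((R ((i + 1 : ℕ) : ℝ≥0) ω - R (i : ℝ≥0) ω : ℕ) : ℝ)
        = (R ((i + 1 : ℕ) : ℝ≥0) ω : ℝ) - R (i : ℝ≥0) ω := by
      intro i
      rw [Nat.cast_sub]
      exact hmono (by push_cast; exact le_self_add)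
    simp_rw [this]
    rw [Finset.sum_range_sub (fun i : ℕ => (R (i : ℝ≥0) ω : ℝ))]
    simp [h0]
  · have := (hlaw 0).map_eq ▸ hint
    exact this.comp_aemeasurable (hlaw 0).aemeasurable
  · intro i j hij
    exact (hind.indepFun hij).comp hm hm
  · intro i
    have : IdentDistrib (fun ω => R ((i + 1 : ℕ) : ℝ≥0) ω - R (i : ℝ≥0) ω)
      (fun ω => R ((0 + 1 : ℕ) : ℝ≥0) ω - R ((0 : ℕ) : ℝ≥0) ω) P P :=
      ⟨(hlaw i).aemeasurable, (hlaw 0).aemeasurable, (hlaw i).map_eq.trans (hlaw 0).map_eq.symm⟩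
    exact this.comp hm

/-- Law of large numbers: the path of a unit Poisson process stays within sublinear distance of
the identity. -/
lemma ae_abs_sub_le {R : ℝ≥0 → Ω → ℕ} (hR : IsUnitPoissonProcess P R) :
    ∀ᵐ ω ∂P, ∀ δ : ℝ, 0 < δ → ∃ C : ℝ, ∀ u : ℝ≥0, |(R u ω : ℝ) - u| ≤ δ * u + C := by
  filter_upwards [hR.tendsto_nat_div, hR.mono] with ω h hm δ hδ
  exact exists_abs_sub_le_of_tendsto_nat hm h hδ

/-- Over an interval of length `h`, independent Poisson processes run at constant speeds jump
twice in total with probability `O(h ^ 2)`. -/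
lemma measure_two_le_sum_increments {ι : Type*} [Fintype ι] {R : ι → ℝ≥0 → Ω → ℕ}
    (hR : ∀ i, IsUnitPoissonProcess P (R i))
    (hindep : iIndepFun (fun i ω (t : ℝ≥0) => R i t ω) P) (c : ι → ℝ≥0) {s t : ℝ≥0} (hst : s ≤ t) :
    P {ω | 2 ≤ ∑ i, (R i (c i * t) ω - R i (c i * s) ω)} ≤
      ENNReal.ofReal ((∑ i, (c i : ℝ)) ^ 2 * ((t : ℝ) - s) ^ 2) := by
  classical
  set D : ι → Ω → ℕ := fun i ω => R i (c i * t) ω - R i (c i * s) ω with hD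
  have hlaw : ∀ i, HasLaw (D i) (poissonMeasure (c i * (t - s))) P := fun i => by
    have := (hR i).increment_law (c i * s) (c i * t) (by gcongr)
    rwa [← mul_tsub] at this
  have hcast : ∀ i, ((c i * (t - s) : ℝ≥0) : ℝ) = c i * ((t : ℝ) - s) := fun i => by
    rw [NNReal.coe_mul, NNReal.coe_sub hst]
  have hts : (0 : ℝ) ≤ (t : ℝ) - s := sub_nonneg.2 (by exact_mod_cast hst)
  have h1 : ∀ i, P {ω | 1 ≤ D i ω} ≤ ENNReal.ofReal (c i * ((t : ℝ) - s)) := fun i => by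
    rw [(hlaw i).measure_eq (p := fun n => 1 ≤ n) (MeasurableSet.of_discrete), ← hcast]
    exact poissonMeasure_one_le _
  have h2 : ∀ i, P {ω | 2 ≤ D i ω} ≤ ENNReal.ofReal ((c i * ((t : ℝ) - s)) ^ 2) := fun i => by
    rw [(hlaw i).measure_eq (p := fun n => 2 ≤ n) (MeasurableSet.of_discrete), ← hcast]
    exact poissonMeasure_two_le _
  -- the event of two jumps indexed by the (possibly equal) pair of processes responsible for them
  let B : ι × ι → Set Ω := fun p =>
    if p.1 = p.2 then {ω | 2 ≤ D p.1 ω} else {ω | 1 ≤ D p.1 ω} ∩ {ω | 1 ≤ D p.2 ω}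
  have hB : ∀ p, P (B p) ≤
      ENNReal.ofReal ((c p.1 * ((t : ℝ) - s)) * (c p.2 * ((t : ℝ) - s))) := by
    rintro ⟨i, j⟩
    by_cases hij : i = j
    · subst hij
      simp only [B, if_true]
      rw [← pow_two]
      exact h2 i
    · simp only [B, if_neg hij]
      have hi : IndepFun (D i) (D j) P := by
        have hm : ∀ k, Measurable (fun f : ℝ≥0 → ℕ => f (c k * t) - f (c k * s)) := fun k => by
          fun_prop
        exact (hindep.indepFun hij).comp (hm i) (hm j)
      have e := hi.measure_inter_preimage_eq_mul {n | 1 ≤ n} {n | 1 ≤ n}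
        MeasurableSet.of_discrete MeasurableSet.of_discrete
      simp only [Set.preimage_ofPred_eq] at e
      rw [e, ENNReal.ofReal_mul (by positivity)]
      exact mul_le_mul' (h1 i) (h1 j)
  have hsub : {ω | 2 ≤ ∑ i, D i ω} ⊆ ⋃ p, B p := by
    intro ω hω
    simp only [Set.mem_ofPred_eq] at hω
    have hne : ∑ i, D i ω ≠ 0 := by omega
    obtain ⟨i, -, hi⟩ := Finset.exists_ne_zero_of_sum_ne_zero hne
    by_cases hi2 : 2 ≤ D i ω
    · exact Set.mem_iUnion.2 ⟨(i, i), by simpa [B] using hi2⟩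
    · have := Finset.add_sum_erase Finset.univ (fun i => D i ω) (Finset.mem_univ i)
      have hne' : ∑ j ∈ Finset.univ.erase i, D j ω ≠ 0 := by omega
      obtain ⟨j, hj, hj'⟩ := Finset.exists_ne_zero_of_sum_ne_zero hne'
      have hij : i ≠ j := (Finset.ne_of_mem_erase hj).symm
      refine Set.mem_iUnion.2 ⟨(i, j), ?_⟩
      simp only [B, if_neg hij]
      exact ⟨Nat.one_le_iff_ne_zero.2 hi, Nat.one_le_iff_ne_zero.2 hj'⟩
  calc P {ω | 2 ≤ ∑ i, D i ω} ≤ P (⋃ p, B p) := measure_mono hsub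
    _ ≤ ∑ p, P (B p) := measure_iUnion_fintype_le _ _
    _ ≤ ∑ p : ι × ι, ENNReal.ofReal ((c p.1 * ((t : ℝ) - s)) * (c p.2 * ((t : ℝ) - s))) :=
        Finset.sum_le_sum (fun p _ => hB p)
    _ = ENNReal.ofReal (∑ p : ι × ι, (c p.1 * ((t : ℝ) - s)) * (c p.2 * ((t : ℝ) - s))) := by
        rw [ENNReal.ofReal_sum_of_nonneg (fun p _ => by positivity)]
    _ = _ := by
        congr 1
        rw [← Finset.univ_product_univ, Finset.sum_product]
        simp_rw [← Finset.mul_sum, ← Finset.sum_mul]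
        ring

/-- Almost surely, the sum of independent Poisson processes run at constant speeds only has jumps of
size one: no process has a double jump, and no two processes jump together. For every `K`, the
probability that an interval of the partition of `[0, K]` into `n + 1` equal parts contains two
jumps tends to `0` with the mesh. -/
lemma ae_sum_le_sum_add_one {ι : Type*} [Fintype ι] {R : ι → ℝ≥0 → Ω → ℕ}
    (hR : ∀ i, IsUnitPoissonProcess P (R i))
    (hindep : iIndepFun (fun i ω (t : ℝ≥0) => R i t ω) P) (c : ι → ℝ≥0) :
    ∀ᵐ ω ∂P, ∀ u : ℝ≥0, 0 < u →
      ∃ v < u, ∑ i, R i (c i * u) ω ≤ ∑ i, R i (c i * v) ω + 1 := by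
  set A := (∑ i, (c i : ℝ)) ^ 2 with hA
  -- the points of the partition of `[0, K]` into `n + 1` intervals of equal length
  let τ : ℕ → ℕ → ℕ → ℝ≥0 := fun K n k => (k : ℝ≥0) * (K / (n + 1))
  let bad : ℕ → ℕ → Set Ω := fun K n =>
    ⋃ k : Fin (n + 1), {ω | 2 ≤ ∑ i, (R i (c i * τ K n (k + 1)) ω - R i (c i * τ K n k) ω)}
  have hbad : ∀ K n, P (bad K n) ≤ ENNReal.ofReal (A * K ^ 2 / (n + 1)) := by
    intro K n
    have hk : ∀ k : Fin (n + 1),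
        P {ω | 2 ≤ ∑ i, (R i (c i * τ K n (k + 1)) ω - R i (c i * τ K n k) ω)} ≤
          ENNReal.ofReal (A * (K / (n + 1)) ^ 2) := by
      intro k
      refine (measure_two_le_sum_increments hR hindep c ?_).trans (le_of_eq ?_)
      · simp only [τ]; gcongr; simp
      · congr 2
        simp only [τ]
        push_cast
        ring
    refine (measure_iUnion_fintype_le _ _).trans ((Finset.sum_le_sum fun k _ => hk k).trans ?_)
    rw [Finset.sum_const, Finset.card_univ, Fintype.card_fin, nsmul_eq_mul,
      ← ENNReal.ofReal_natCast, ← ENNReal.ofReal_mul (by positivity)]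
    apply ENNReal.ofReal_le_ofReal
    push_cast
    apply le_of_eq
    field_simp
  have hnull : ∀ K, P (⋂ n, bad K n) = 0 := by
    intro K
    have hlim : Tendsto (fun n : ℕ => ENNReal.ofReal (A * K ^ 2 / (n + 1))) atTop (𝓝 0) := by
      have := (tendsto_const_div_atTop_nhds_zero_nat (A * (K : ℝ) ^ 2)).comp (tendsto_add_atTop_nat 1)
      have := (ENNReal.continuous_ofReal.tendsto 0).comp this
      simpa [Function.comp_def] using this
    refine le_antisymm (ge_of_tendsto' hlim fun n => ?_) (zero_le)
    exact (measure_mono (Set.iInter_subset _ n)).trans (hbad K n)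
  have hgood : ∀ᵐ ω ∂P, ∀ K : ℕ, ω ∉ ⋂ n, bad K n :=
    ae_all_iff.2 fun K => measure_eq_zero_iff_ae_notMem.1 (hnull K)
  filter_upwards [hgood, ae_all_iff.2 fun i => (hR i).mono] with ω hω hmono u hu
  obtain ⟨K, hK⟩ := exists_nat_gt u
  have hω' := hω K
  simp only [Set.mem_iInter, not_forall] at hω'
  obtain ⟨n, hn⟩ := hω'
  have hKpos : (0 : ℝ≥0) < K := hu.trans hK
  set h : ℝ≥0 := K / (n + 1) with hh
  have hhpos : 0 < h := by positivity
  -- `u` lies in the half-open interval `(k h, (k + 1) h]`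
  set k := ⌈u / h⌉₊ - 1 with hkdef
  have hceil : 0 < ⌈u / h⌉₊ := Nat.ceil_pos.2 (by positivity)
  have hk1 : ⌈u / h⌉₊ = k + 1 := by omega
  have hup : u ≤ ((k + 1 : ℕ) : ℝ≥0) * h := by
    rw [← hk1, ← div_le_iff₀ hhpos]; exact Nat.le_ceil _
  have hlow : (k : ℝ≥0) * h < u := by
    rw [← lt_div_iff₀ hhpos]; exact Nat.lt_ceil.1 (by omega)
  have hkn : k < n + 1 := by
    have h1 : (k : ℝ≥0) * h < ((n + 1 : ℕ) : ℝ≥0) * h := by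
      refine hlow.trans (hK.trans_le (le_of_eq ?_))
      rw [hh]; push_cast; field_simp
    exact_mod_cast lt_of_mul_lt_mul_right h1 (zero_le)
  refine ⟨k * h, hlow, ?_⟩
  have hno : ¬ 2 ≤ ∑ i, (R i (c i * τ K n (k + 1)) ω - R i (c i * τ K n k) ω) := by
    intro hcon
    exact hn (Set.mem_iUnion.2 ⟨⟨k, hkn⟩, hcon⟩)
  have h1 : ∑ i, R i (c i * u) ω ≤ ∑ i, R i (c i * τ K n (k + 1)) ω :=
    Finset.sum_le_sum fun i _ => hmono i (by simp only [τ]; gcongr)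
  have h2 : ∑ i, R i (c i * τ K n (k + 1)) ω ≤
      ∑ i, R i (c i * τ K n k) ω + ∑ i, (R i (c i * τ K n (k + 1)) ω - R i (c i * τ K n k) ω) := by
    rw [← Finset.sum_add_distrib]
    exact Finset.sum_le_sum fun i _ => by omega
  change _ ≤ ∑ i, R i (c i * τ K n k) ω + 1
  omega

end IsUnitPoissonProcess

/-! ### Periodic graphs and the reduction to the unit cell -/

lemma projCell_mem_unitCell {d : ℕ} (x : Space d) : projCell x ∈ unitCell d :=
  fun _ => ⟨Int.fract_nonneg _, Int.fract_lt_one _⟩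

lemma projCell_of_mem_unitCell {d : ℕ} {x : Space d} (hx : x ∈ unitCell d) : projCell x = x := by
  ext i
  exact Int.fract_eq_self.2 (hx i)

lemma projCell_add_intVec {d : ℕ} (x : Space d) (n : Fin d → ℤ) :
    projCell (x + intVec n) = projCell x := by
  ext i
  simp [projCell, intVec]

lemma exists_eq_projCell_add_intVec {d : ℕ} (x : Space d) :
    ∃ n : Fin d → ℤ, x = projCell x + intVec n := by
  refine ⟨fun i => ⌊x i⌋, ?_⟩
  ext i
  simp [projCell, intVec]

lemma intVec_neg {d : ℕ} (n : Fin d → ℤ) : intVec (-n) = -intVec n := by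
  ext i
  simp [intVec]

lemma measurable_projCell {d : ℕ} : Measurable (projCell : Space d → Space d) := by
  unfold projCell
  refine (WithLp.measurable_toLp 2 (Fin d → ℝ)).comp (measurable_pi_lambda _ fun i => ?_)
  exact measurable_fract.comp (by fun_prop)

namespace PeriodicGraph

variable {d : ℕ} (G : PeriodicGraph d)

lemma mem_cellNodes {x : Space d} : x ∈ G.cellNodes ↔ x ∈ G.nodes ∧ x ∈ unitCell d := by
  simp [cellNodes]

lemma mem_cellEdges {e : Space d × Space d} :
    e ∈ G.cellEdges ↔ e ∈ G.edges ∧ e.1 ∈ unitCell d := by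
  simp [cellEdges]

lemma projCell_mem_cellNodes {x : Space d} (hx : x ∈ G.nodes) : projCell x ∈ G.cellNodes := by
  refine G.mem_cellNodes.2 ⟨?_, projCell_mem_unitCell x⟩
  obtain ⟨n, hn⟩ := exists_eq_projCell_add_intVec x
  have := G.nodes_translate (-n) x hx
  rwa [intVec_neg, ← sub_eq_add_neg, ← eq_sub_of_add_eq hn.symm] at this

lemma fst_mem_cellNodes {e : Space d × Space d} (he : e ∈ G.cellEdges) : e.1 ∈ G.cellNodes :=
  G.mem_cellNodes.2 ⟨(G.edges_subset (G.mem_cellEdges.1 he).1).1, (G.mem_cellEdges.1 he).2⟩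

lemma projCell_snd_mem_cellNodes {e : Space d × Space d} (he : e ∈ G.cellEdges) :
    projCell e.2 ∈ G.cellNodes :=
  G.projCell_mem_cellNodes (G.edges_subset (G.mem_cellEdges.1 he).1).2

lemma rate_pos_of_mem {e : Space d × Space d} (he : e ∈ G.cellEdges) : 0 < G.rate e :=
  G.rate_pos e (G.mem_cellEdges.1 he).1

/-- A jump along the edge `e` from a node that projects to the origin of `e` leads to a node that
projects to the projection of the end of `e`. -/
lemma add_jump_mem {e : Space d × Space d} (he : e ∈ G.cellEdges) {z : Space d}
    (hz : projCell z = e.1) :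
    z + (e.2 - e.1) ∈ G.nodes ∧ projCell (z + (e.2 - e.1)) = projCell e.2 := by
  obtain ⟨n, hn⟩ := exists_eq_projCell_add_intVec z
  have h : z + (e.2 - e.1) = e.2 + intVec n := by rw [hn, hz]; abel
  rw [h, projCell_add_intVec]
  exact ⟨G.nodes_translate n _ (G.edges_subset (G.mem_cellEdges.1 he).1).2, rfl⟩

/-- Every edge is a translate of an edge that originates in the unit cell. -/
lemma exists_cellEdge {a b : Space d} (h : (a, b) ∈ G.edges) :
    ∃ e ∈ G.cellEdges, e.1 = projCell a ∧ projCell e.2 = projCell b := by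
  obtain ⟨n, hn⟩ := exists_eq_projCell_add_intVec a
  have h' := G.edges_translate (-n) a b h
  have ha : a + intVec (-n) = projCell a := by
    rw [intVec_neg, ← sub_eq_add_neg, ← eq_sub_of_add_eq hn.symm]
  rw [ha] at h'
  exact ⟨_, G.mem_cellEdges.2 ⟨h', projCell_mem_unitCell a⟩, rfl, projCell_add_intVec _ _⟩

/-! ### The Poisson equation of the projected walk -/

open Classical in
/-- The rate matrix acts as the generator of the projected walk. -/
lemma rateMatrix_mulVec_apply (f : Space d → ℝ) (x : G.cellNodes) :
    G.rateMatrix.mulVec (fun y => f y.1) x =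
      ∑ e ∈ G.cellEdges with e.1 = x.1, G.rate e * (f (projCell e.2) - f e.1) := by
  have h1 : G.rateMatrix.mulVec (fun y => f y.1) x =
      ∑ y, G.cellRate x y * (f y.1 - f x.1) := by
    rw [Matrix.mulVec, dotProduct, ← Finset.add_sum_erase _ _ (Finset.mem_univ x),
      ← Finset.add_sum_erase Finset.univ (fun y => G.cellRate x y * (f y.1 - f x.1))
        (Finset.mem_univ x)]
    have : ∀ y ∈ Finset.univ.erase x, G.rateMatrix x y * f y.1 = G.cellRate x y * f y.1 := by
      intro y hy
      rw [rateMatrix, if_neg (Finset.ne_of_mem_erase hy).symm]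
    rw [Finset.sum_congr rfl this]
    simp only [rateMatrix, if_true, sub_self, mul_zero, zero_add, mul_sub, Finset.sum_sub_distrib,
      ← Finset.sum_mul]
    ring
  rw [h1]
  simp_rw [cellRate, Finset.sum_mul]
  have h2 : ∀ y : G.cellNodes,
      ∑ e ∈ G.cellEdges with e.1 = x.1 ∧ projCell e.2 = y.1, G.rate e * (f y.1 - f x.1) =
      ∑ e ∈ G.cellEdges with e.1 = x.1,
        if projCell e.2 = y.1 then G.rate e * (f (projCell e.2) - f e.1) else 0 := by
    intro y
    rw [← Finset.filter_filter, Finset.sum_filter _ (fun e => G.rate e * (f y.1 - f x.1))]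
    refine Finset.sum_congr rfl fun e he => ?_
    split_ifs with h
    · rw [h, (Finset.mem_filter.1 he).2]
    · rfl
  simp_rw [h2]
  rw [Finset.sum_comm]
  refine Finset.sum_congr rfl fun e he => ?_
  have hmem := G.projCell_snd_mem_cellNodes (Finset.mem_filter.1 he).1
  rw [Finset.sum_eq_single (⟨projCell e.2, hmem⟩ : G.cellNodes)]
  · simp
  · intro y _ hy
    rw [if_neg]
    intro h
    exact hy (Subtype.ext h.symm)
  · simp

open Classical in
/-- The maximum principle: a harmonic function of the projected walk is constant. -/
lemma eq_of_rateMatrix_mulVec_eq_zero {g : G.cellNodes → ℝ} (hg : G.rateMatrix.mulVec g = 0)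
    (x y : G.cellNodes) : g x = g y := by
  let f : Space d → ℝ := fun w => if h : w ∈ G.cellNodes then g ⟨w, h⟩ else 0
  have hfg : ∀ w : G.cellNodes, f w.1 = g w := fun w => by simp [f]
  obtain ⟨m, -, hm⟩ := Finset.exists_max_image Finset.univ g ⟨x, Finset.mem_univ x⟩
  have hle : ∀ w ∈ G.cellNodes, f w ≤ g m := fun w hw => by
    rw [hfg ⟨w, hw⟩]; exact hm _ (Finset.mem_univ _)
  have key : ∀ w, Relation.ReflTransGen (fun a b => (a, b) ∈ G.edges) m.1 w →
      f (projCell w) = g m := by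
    intro w hw
    induction hw with
    | refl =>
      rw [projCell_of_mem_unitCell (G.mem_cellNodes.1 m.2).2, hfg]
    | @tail a b _ hab ih =>
      obtain ⟨e, he, he1, he2⟩ := G.exists_cellEdge hab
      have hz := congrFun hg ⟨projCell a, he1 ▸ G.fst_mem_cellNodes he⟩
      have : g = fun w : G.cellNodes => f w.1 := funext fun w => (hfg w).symm
      rw [this, rateMatrix_mulVec_apply, Pi.zero_apply] at hz
      -- at a point of maximum all terms of the generator are nonpositive
      have hterm := (Finset.sum_eq_zero_iff_of_nonpos (fun e' he' => ?_)).1 hz e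
        (Finset.mem_filter.2 ⟨he, he1⟩)
      · have := (mul_eq_zero.1 hterm).resolve_left (G.rate_pos_of_mem he).ne'
        rw [he1, he2, ih] at this
        linarith
      · obtain ⟨h1, h2⟩ := Finset.mem_filter.1 he'
        refine mul_nonpos_of_nonneg_of_nonpos (G.rate_pos_of_mem h1).le ?_
        simp only at h2
        rw [h2, ih]
        exact sub_nonpos.2 (hle _ (G.projCell_snd_mem_cellNodes h1))
  have hall : ∀ w : G.cellNodes, g w = g m := by
    intro w
    have := key w.1 (G.strongly_connected _ (G.mem_cellNodes.1 m.2).1 _ (G.mem_cellNodes.1 w.2).1)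
    rwa [projCell_of_mem_unitCell (G.mem_cellNodes.1 w.2).2, hfg] at this
  rw [hall x, hall y]

/-- Solvability of the Poisson equation: the range of the rate matrix is the orthogonal of the
stationary measure. The range lies in that hyperplane by stationarity, and has the same dimension
because the kernel consists of the constants. -/
lemma exists_mulVec_eq {π : G.cellNodes → ℝ} (hπ : G.IsStationary π) {g : G.cellNodes → ℝ}
    (hg : ∑ y, π y * g y = 0) : ∃ f : G.cellNodes → ℝ, G.rateMatrix.mulVec f = g := by
  classical
  let Lm : (G.cellNodes → ℝ) →ₗ[ℝ] (G.cellNodes → ℝ) := G.rateMatrix.mulVecLin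
  let φ : (G.cellNodes → ℝ) →ₗ[ℝ] ℝ := ∑ y, π y • LinearMap.proj y
  have hφ : ∀ h, φ h = ∑ y, π y * h y := fun h => by simp [φ]
  have hle : LinearMap.range Lm ≤ LinearMap.ker φ := by
    rintro _ ⟨f, rfl⟩
    rw [LinearMap.mem_ker, hφ]
    change π ⬝ᵥ (G.rateMatrix.mulVec f) = 0
    rw [Matrix.dotProduct_mulVec, ← Matrix.mulVec_transpose, hπ.transpose_mulVec_eq_zero,
      zero_dotProduct]
  have hker : LinearMap.ker Lm ≤ Submodule.span ℝ {fun _ => (1 : ℝ)} := by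
    intro f hf
    rw [Submodule.mem_span_singleton]
    rcases isEmpty_or_nonempty G.cellNodes with h | ⟨⟨x⟩⟩
    · exact ⟨0, Subsingleton.elim _ _⟩
    · exact ⟨f x, funext fun y => by
        simpa using G.eq_of_rateMatrix_mulVec_eq_zero (g := f) hf x y⟩
  have h1 := (Submodule.finrank_mono hker).trans (finrank_span_le_card _)
  rw [Set.toFinset_card, Set.card_singleton] at h1
  have h2 := LinearMap.finrank_range_add_finrank_ker Lm
  have h3 := LinearMap.finrank_range_add_finrank_ker φ
  have hne : φ (fun _ => 1) = 1 := by rw [hφ]; simpa using hπ.sum_eq_one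
  have h4 : Module.finrank ℝ (LinearMap.range φ) = 1 := by
    rw [LinearMap.range_eq_top.2 (LinearMap.surjective (by
      intro h0; rw [h0] at hne; simp at hne)), finrank_top, Module.finrank_self]
  have := Submodule.eq_of_le_of_finrank_le hle (by omega)
  have hmem : g ∈ LinearMap.range Lm := by
    rw [this, LinearMap.mem_ker, hφ, hg]
  obtain ⟨f, hf⟩ := hmem
  exact ⟨f, hf⟩

end PeriodicGraph

/-! ### Occupation times of a right-continuous path -/

/-- A right-continuous function of a real variable is Borel measurable: it is the pointwise limit of
its values at the next point to the right in the grid of mesh `1 / (n + 1)`. -/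
lemma measurable_of_forall_continuousWithinAt_Ici {E : Type*} [TopologicalSpace E]
    [TopologicalSpace.PseudoMetrizableSpace E] [MeasurableSpace E] [BorelSpace E] {f : ℝ → E}
    (hf : ∀ t, ContinuousWithinAt f (Set.Ici t) t) : Measurable f := by
  let a : ℕ → ℝ → ℝ := fun n t => ((⌊t * (n + 1)⌋ : ℝ) + 1) / (n + 1)
  refine measurable_of_tendsto_metrizable (f := fun n t => f (a n t)) (fun n => ?_) ?_
  · have h : Measurable (fun k : ℤ => f (((k : ℝ) + 1) / (n + 1))) := measurable_from_top
    exact h.comp (Int.measurable_floor.comp (measurable_id.mul_const _))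
  · rw [tendsto_pi_nhds]
    intro t
    have hlow : ∀ n, t ≤ a n t := fun n => by
      have : (0 : ℝ) < n + 1 := by positivity
      rw [le_div_iff₀ this]
      exact (Int.lt_floor_add_one _).le
    have hup : ∀ n : ℕ, a n t ≤ t + 1 / ((n : ℝ) + 1) := fun n => by
      have : (0 : ℝ) < n + 1 := by positivity
      rw [div_le_iff₀ this, add_mul, one_div, inv_mul_cancel₀ this.ne']
      linarith [Int.floor_le (t * ((n : ℝ) + 1))]
    refine (hf t).tendsto.comp (tendsto_nhdsWithin_iff.2 ⟨?_, Eventually.of_forall hlow⟩)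
    refine tendsto_of_tendsto_of_tendsto_of_le_of_le tendsto_const_nhds ?_ hlow hup
    simpa using tendsto_const_nhds.add (tendsto_one_div_add_atTop_nhds_zero_nat (𝕜 := ℝ))

open Classical in
/-- The time that the projection of the path `z` on the unit cell spends at `x` up to time `t`. -/
def occupationTime {d : ℕ} (z : ℝ → Space d) (x : Space d) (t : ℝ) : ℝ :=
  ∫ s in (0 : ℝ)..t, if projCell (z s) = x then (1 : ℝ) else 0

section Occupation

variable {d : ℕ} {z : ℝ → Space d}

lemma occupationTime_zero (x : Space d) : occupationTime z x 0 = 0 := by simp [occupationTime]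

open Classical in
lemma intervalIntegrable_visit (hz : ∀ t, 0 ≤ t → ContinuousWithinAt z (Set.Ici t) t)
    (x : Space d) {s t : ℝ} (hs : 0 ≤ s) (ht : 0 ≤ t) :
    IntervalIntegrable (fun u => if projCell (z u) = x then (1 : ℝ) else 0) volume s t := by
  have hm : Measurable fun u => z (max u 0) := by
    refine measurable_of_forall_continuousWithinAt_Ici fun u => ?_
    refine (hz (max u 0) (le_max_right _ _)).comp (f := fun u => max u (0 : ℝ))
      (by fun_prop) fun v hv => ?_
    exact Set.mem_Ici.2 (max_le_max_right 0 (Set.mem_Ici.1 hv))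
  have hm' : Measurable fun u => if projCell (z (max u 0)) = x then (1 : ℝ) else 0 :=
    Measurable.ite ((measurable_projCell.comp hm) (measurableSet_singleton x))
      measurable_const measurable_const
  have hi : IntervalIntegrable (fun u => if projCell (z (max u 0)) = x then (1 : ℝ) else 0)
      volume s t := by
    refine (intervalIntegrable_const (c := (1 : ℝ))).mono_fun hm'.aestronglyMeasurable ?_
    refine Eventually.of_forall fun u => ?_
    dsimp only
    split_ifs <;> simp
  refine hi.congr fun u hu => ?_
  have : 0 ≤ u := (le_min hs ht).trans hu.1.le
  simp only [max_eq_left this]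

open Classical in
lemma occupationTime_sub (hz : ∀ t, 0 ≤ t → ContinuousWithinAt z (Set.Ici t) t)
    (x : Space d) {s t : ℝ} (hs : 0 ≤ s) (ht : 0 ≤ t) :
    occupationTime z x t - occupationTime z x s =
      ∫ u in s..t, if projCell (z u) = x then (1 : ℝ) else 0 :=
  intervalIntegral.integral_interval_sub_left (intervalIntegrable_visit hz x le_rfl ht)
    (intervalIntegrable_visit hz x le_rfl hs)

lemma occupationTime_mono (hz : ∀ t, 0 ≤ t → ContinuousWithinAt z (Set.Ici t) t)
    (x : Space d) {s t : ℝ} (hs : 0 ≤ s) (hst : s ≤ t) :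
    occupationTime z x s ≤ occupationTime z x t := by
  classical
  rw [← sub_nonneg, occupationTime_sub hz x hs (hs.trans hst)]
  refine intervalIntegral.integral_nonneg hst fun u _ => ?_
  split_ifs <;> simp

lemma occupationTime_sub_le (hz : ∀ t, 0 ≤ t → ContinuousWithinAt z (Set.Ici t) t)
    (x : Space d) {s t : ℝ} (hs : 0 ≤ s) (hst : s ≤ t) :
    occupationTime z x t - occupationTime z x s ≤ t - s := by
  classical
  rw [occupationTime_sub hz x hs (hs.trans hst)]
  have := intervalIntegral.integral_mono_on hst
    (intervalIntegrable_visit hz x hs (hs.trans hst)) (intervalIntegrable_const (c := (1 : ℝ)))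
    (fun u _ => by split_ifs <;> simp)
  simpa using this

lemma occupationTime_nonneg (hz : ∀ t, 0 ≤ t → ContinuousWithinAt z (Set.Ici t) t)
    (x : Space d) {t : ℝ} (ht : 0 ≤ t) : 0 ≤ occupationTime z x t := by
  simpa [occupationTime_zero] using occupationTime_mono hz x le_rfl ht

lemma occupationTime_le (hz : ∀ t, 0 ≤ t → ContinuousWithinAt z (Set.Ici t) t)
    (x : Space d) {t : ℝ} (ht : 0 ≤ t) : occupationTime z x t ≤ t := by
  simpa [occupationTime_zero] using occupationTime_sub_le hz x le_rfl ht

open Classical in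
/-- While the projected path stays at `y`, only the occupation time of `y` grows, at unit speed. -/
lemma occupationTime_of_forall_eq (hz : ∀ t, 0 ≤ t → ContinuousWithinAt z (Set.Ici t) t)
    (x : Space d) {y : Space d} {s t : ℝ} (hs : 0 ≤ s) (hst : s ≤ t)
    (h : ∀ u, s ≤ u → u < t → projCell (z u) = y) :
    occupationTime z x t = occupationTime z x s + if x = y then t - s else 0 := by
  have h1 := occupationTime_sub hz x hs (hs.trans hst)
  have h2 : ∫ u in s..t, (if projCell (z u) = x then (1 : ℝ) else 0) =
      ∫ u in s..t, if x = y then (1 : ℝ) else 0 := by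
    refine intervalIntegral.integral_congr_Ioo_of_le hst fun u hu => ?_
    simp only [h u hu.1.le hu.2, eq_comm]
  rw [h2] at h1
  split_ifs at h1 ⊢ <;> simp at h1 <;> linarith

lemma sum_occupationTime (hz : ∀ t, 0 ≤ t → ContinuousWithinAt z (Set.Ici t) t)
    {S : Finset (Space d)} (hS : ∀ t, 0 ≤ t → projCell (z t) ∈ S) {t : ℝ} (ht : 0 ≤ t) :
    ∑ x ∈ S, occupationTime z x t = t := by
  classical
  unfold occupationTime
  rw [← intervalIntegral.integral_finsetSum
    fun x _ => intervalIntegrable_visit hz x le_rfl ht]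
  have : ∫ u in (0 : ℝ)..t, ∑ x ∈ S, (if projCell (z u) = x then (1 : ℝ) else 0) =
      ∫ u in (0 : ℝ)..t, (1 : ℝ) := by
    refine intervalIntegral.integral_congr fun u hu => ?_
    rw [Set.uIcc_of_le ht] at hu
    simp [hS u hu.1]
  rw [this]
  simp

end Occupation

/-! ### Paths of the random time change representation -/

namespace PeriodicGraph

variable {d : ℕ} (G : PeriodicGraph d)

/-- A single realisation of the random time change representation: the right-continuous path `z`
started from `z₀` is driven by counting paths `r e` that start from `0` and increase by jumps of
size one. The last requirement bears on the total `∑ e, r e (λ_e u)`, so that it also excludes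
simultaneous jumps of two edges with the same origin. -/
structure IsDrivenPath (r : G.cellEdges → ℝ≥0 → ℕ) (z₀ : Space d) (z : ℝ → Space d) : Prop where
  mono : ∀ e, Monotone (r e)
  zero : ∀ e, r e 0 = 0
  driver_right_continuous : ∀ e t, ContinuousWithinAt (r e) (Set.Ici t) t
  simple : ∀ u : ℝ≥0, 0 < u → ∃ v < u, ∑ e : G.cellEdges, r e ((G.rate e.1).toNNReal * u) ≤
    ∑ e : G.cellEdges, r e ((G.rate e.1).toNNReal * v) + 1
  right_continuous : ∀ t, 0 ≤ t → ContinuousWithinAt z (Set.Ici t) t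
  time_change : ∀ t, 0 ≤ t → z t = z₀ + ∑ e : G.cellEdges,
    (r e ((G.rate e.1).toNNReal * (occupationTime z e.1.1 t).toNNReal) : ℝ) • (e.1.2 - e.1.1)

/-- The number of jumps of the path along translates of the edge `e` up to time `t`. -/
def jumpCount (r : G.cellEdges → ℝ≥0 → ℕ) (z : ℝ → Space d) (e : G.cellEdges) (t : ℝ) : ℕ :=
  r e ((G.rate e.1).toNNReal * (occupationTime z e.1.1 t).toNNReal)

namespace IsDrivenPath

variable {G} {r : G.cellEdges → ℝ≥0 → ℕ} {z₀ : Space d} {z : ℝ → Space d}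
  (h : G.IsDrivenPath r z₀ z)
include h

lemma eq_add_sum {t : ℝ} (ht : 0 ≤ t) :
    z t = z₀ + ∑ e : G.cellEdges, (G.jumpCount r z e t : ℝ) • (e.1.2 - e.1.1) :=
  h.time_change t ht

lemma jumpCount_zero (e : G.cellEdges) : G.jumpCount r z e 0 = 0 := by
  simp [jumpCount, occupationTime_zero, h.zero]

lemma jumpCount_mono (e : G.cellEdges) {s t : ℝ} (hs : 0 ≤ s) (hst : s ≤ t) :
    G.jumpCount r z e s ≤ G.jumpCount r z e t := by
  have := occupationTime_mono h.right_continuous e.1.1 hs hst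
  exact h.mono e (by gcongr)

lemma eventually_jumpCount_eq (e : G.cellEdges) {t : ℝ} (ht : 0 ≤ t) :
    ∀ᶠ s in 𝓝[≥] t, G.jumpCount r z e s = G.jumpCount r z e t := by
  set clock : ℝ → ℝ≥0 :=
    fun s => (G.rate e.1).toNNReal * (occupationTime z e.1.1 s).toNNReal with hclock
  have hc : ContinuousWithinAt (occupationTime z e.1.1) (Set.Ici t) t := by
    have hup : Tendsto (fun s => occupationTime z e.1.1 t + (s - t)) (𝓝[≥] t)
        (𝓝 (occupationTime z e.1.1 t)) := by
      have : Continuous fun s => occupationTime z e.1.1 t + (s - t) := by fun_prop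
      simpa using this.continuousWithinAt (s := Set.Ici t) (x := t) |>.tendsto
    refine tendsto_of_tendsto_of_tendsto_of_le_of_le' tendsto_const_nhds hup ?_ ?_
    · filter_upwards [self_mem_nhdsWithin] with s hs
      exact occupationTime_mono h.right_continuous _ ht hs
    · filter_upwards [self_mem_nhdsWithin] with s hs
      linarith [occupationTime_sub_le h.right_continuous e.1.1 ht hs]
  have hcl : Tendsto clock (𝓝[≥] t) (𝓝[≥] (clock t)) := by
    refine tendsto_nhdsWithin_iff.2 ⟨?_, ?_⟩
    · exact ((continuous_real_toNNReal.tendsto _).comp hc.tendsto).const_mul _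
    · filter_upwards [self_mem_nhdsWithin] with s hs
      have := occupationTime_mono h.right_continuous e.1.1 ht hs
      simp only [hclock, Set.mem_Ici]
      gcongr
  have := (h.driver_right_continuous e (clock t)).tendsto.comp hcl
  rw [nhds_discrete, tendsto_pure] at this
  exact this

/-- The flow balance along the path. The path stays in the set of nodes, and its jumps are jumps
along the edges that originate at its current position, one at a time; so the increment of a
function of the projected path is the sum of its increments over the jumps. -/
theorem mem_nodes_and_balance (hz₀ : z₀ ∈ G.nodes) {t : ℝ} (ht : 0 ≤ t) :
    z t ∈ G.nodes ∧ ∀ f : Space d → ℝ, f (projCell (z t)) = f (projCell z₀) +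
      ∑ e : G.cellEdges, (G.jumpCount r z e t : ℝ) * (f (projCell e.1.2) - f e.1.1) := by
  set M : ℝ → ℕ := fun s => ∑ e : G.cellEdges, G.jumpCount r z e s with hM
  have hMmono : ∀ {s u : ℝ}, 0 ≤ s → s ≤ u → M s ≤ M u := fun hs hsu =>
    Finset.sum_le_sum fun e _ => h.jumpCount_mono e hs hsu
  -- by monotonicity the total number of jumps determines all the counts
  have hdet : ∀ {s u : ℝ}, 0 ≤ s → s ≤ u → M s = M u →
      ∀ e, G.jumpCount r z e s = G.jumpCount r z e u := fun hs hsu heq e =>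
    (Finset.sum_eq_sum_iff_of_le fun e _ => h.jumpCount_mono e hs hsu).1 heq e (Finset.mem_univ e)
  induction hn : M t using Nat.strong_induction_on generalizing t with
  | _ n ih =>
  have hM0 : M 0 = 0 := by simp [hM, h.jumpCount_zero]
  rcases Nat.eq_zero_or_pos n with rfl | hpos
  · have hcount : ∀ e, G.jumpCount r z e t = 0 := fun e => by
      rw [← hdet le_rfl ht (hM0.trans hn.symm) e, h.jumpCount_zero]
    have hzt : z t = z₀ := by simp [h.eq_add_sum ht, hcount]
    simp [hzt, hcount, hz₀]
  -- the time of the last jump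
  set A : Set ℝ := {s | 0 ≤ s ∧ M s = n} with hA
  set τ := sInf A with hτ
  have hAne : A.Nonempty := ⟨t, ht, hn⟩
  have hAb : BddBelow A := ⟨0, fun s hs => hs.1⟩
  have hτ0 : 0 ≤ τ := le_csInf hAne fun s hs => hs.1
  have hτt : τ ≤ t := csInf_le hAb ⟨ht, hn⟩
  have hMτ : M τ = n := by
    have hev : ∀ᶠ s in 𝓝[≥] τ, M s = M τ := by
      filter_upwards [eventually_all.2 fun e => h.eventually_jumpCount_eq e hτ0] with s hs
      exact Finset.sum_congr rfl fun e _ => hs e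
    obtain ⟨b, hb, hsub⟩ := mem_nhdsGE_iff_exists_Ico_subset.1 hev
    obtain ⟨s, hsA, hsb⟩ := exists_lt_of_csInf_lt hAne hb
    exact (hsub ⟨csInf_le hAb hsA, hsb⟩).symm.trans hsA.2
  have hτpos : 0 < τ := hτ0.lt_of_ne fun h0 => by rw [← h0, hM0] at hMτ; omega
  have hlt : ∀ s, 0 ≤ s → s < τ → M s < n := fun s hs hsτ =>
    lt_of_le_of_ne (hMτ ▸ hMmono hs hsτ.le) fun heq => notMem_of_lt_csInf hsτ hAb ⟨hs, heq⟩
  -- a time after which nothing happens before `τ`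
  obtain ⟨s₀, ⟨hs₀, hs₀τ⟩, hmax⟩ : ∃ s₀ ∈ Set.Ico 0 τ, ∀ s ∈ Set.Ico 0 τ, M s ≤ M s₀ := by
    have hne : (M '' Set.Ico 0 τ).Nonempty := ⟨_, 0, ⟨le_rfl, hτpos⟩, rfl⟩
    have hb : BddAbove (M '' Set.Ico 0 τ) :=
      ⟨n, by rintro _ ⟨s, hs, rfl⟩; exact (hlt s hs.1 hs.2).le⟩
    obtain ⟨s₀, hs₀, heq⟩ := Nat.sSup_mem hne hb
    exact ⟨s₀, hs₀, fun s hs => heq ▸ le_csSup hb ⟨s, hs, rfl⟩⟩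
  have hconst : ∀ s, s₀ ≤ s → s < τ → ∀ e, G.jumpCount r z e s = G.jumpCount r z e s₀ :=
    fun s h1 h2 e => (hdet hs₀ h1
      (le_antisymm (hMmono hs₀ h1) (hmax s ⟨hs₀.trans h1, h2⟩)) e).symm
  have hzconst : ∀ s, s₀ ≤ s → s < τ → z s = z s₀ := fun s h1 h2 => by
    rw [h.eq_add_sum (hs₀.trans h1), h.eq_add_sum hs₀]
    simp_rw [hconst s h1 h2]
  obtain ⟨hnode, hbal⟩ := ih (M s₀) (hlt s₀ hs₀ hs₀τ) hs₀ rfl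
  set x := projCell (z s₀) with hx
  have hocc : ∀ y s, s₀ ≤ s → s ≤ τ → occupationTime z y s =
      occupationTime z y s₀ + if y = x then s - s₀ else 0 := fun y s h1 h2 => by
    classical
    rw [occupationTime_of_forall_eq h.right_continuous y hs₀ h1 (y := x)
      fun u hu1 hu2 => by rw [hzconst u hu1 (hu2.trans_le h2)]]
  have hoff : ∀ e : G.cellEdges, e.1.1 ≠ x →
      G.jumpCount r z e τ = G.jumpCount r z e s₀ := fun e he => by
    rw [jumpCount, jumpCount, hocc e.1.1 τ hs₀τ.le le_rfl, if_neg he, add_zero]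
  -- at most one jump occurs at time `τ`
  have hone : M τ ≤ M s₀ + 1 := by
    set u := occupationTime z x τ with hu
    have hu' : u = occupationTime z x s₀ + (τ - s₀) := by
      rw [hu, hocc x τ hs₀τ.le le_rfl, if_pos rfl]
    have hnn := occupationTime_nonneg h.right_continuous x hs₀
    have hupos : 0 < u := by linarith
    obtain ⟨v, hvu, hv⟩ := h.simple u.toNNReal (Real.toNNReal_pos.2 hupos)
    have hvu' : (v : ℝ) < u := Real.lt_toNNReal_iff_coe_lt.1 hvu
    set s := max s₀ (τ - (u - v)) with hs
    have hsτ : s < τ := max_lt hs₀τ (by linarith)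
    have hvs : v ≤ (occupationTime z x s).toNNReal := by
      refine NNReal.le_toNNReal_of_coe_le ?_
      rw [hocc x s (le_max_left _ _) hsτ.le, if_pos rfl]
      linarith [le_max_right s₀ (τ - (u - v))]
    have hedge : ∀ e : G.cellEdges,
        G.jumpCount r z e τ + r e ((G.rate e.1).toNNReal * v) ≤
          G.jumpCount r z e s₀ + r e ((G.rate e.1).toNNReal * u.toNNReal) := fun e => by
      by_cases he : e.1.1 = x
      · have h1 : G.jumpCount r z e τ = r e ((G.rate e.1).toNNReal * u.toNNReal) := by
          rw [jumpCount, he]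
        have h2 : r e ((G.rate e.1).toNNReal * v) ≤ G.jumpCount r z e s₀ := by
          rw [← hconst s (le_max_left _ _) hsτ e, jumpCount, he]
          exact h.mono e (by gcongr)
        omega
      · rw [hoff e he]
        have := h.mono e (mul_le_mul_right hvu.le (G.rate e.1).toNNReal)
        omega
    have := Finset.sum_le_sum fun e (_ : e ∈ Finset.univ) => hedge e
    rw [Finset.sum_add_distrib, Finset.sum_add_distrib] at this
    change M τ + _ ≤ M s₀ + _ at this
    omega
  have hMlt : M s₀ < M τ := hMτ ▸ hlt s₀ hs₀ hs₀τ
  -- so the path follows one edge `e₀`, which originates at its current position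
  obtain ⟨e₀, -, he₀⟩ := Finset.exists_lt_of_sum_lt hMlt
  have he₀x : e₀.1.1 = x := by
    by_contra hne
    exact he₀.ne (hoff e₀ hne).symm
  classical
  have hcount : ∀ e, G.jumpCount r z e t = G.jumpCount r z e s₀ + if e = e₀ then 1 else 0 := by
    have hle : ∀ e ∈ Finset.univ, G.jumpCount r z e s₀ + (if e = e₀ then 1 else 0) ≤
        G.jumpCount r z e τ := fun e _ => by
      split_ifs with he
      · subst he; exact he₀
      · exact h.jumpCount_mono e hs₀ hs₀τ.le
    have hsum : ∑ e : G.cellEdges, (G.jumpCount r z e s₀ + if e = e₀ then 1 else 0) =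
        ∑ e : G.cellEdges, G.jumpCount r z e τ := by
      refine le_antisymm (Finset.sum_le_sum hle) ?_
      rw [Finset.sum_add_distrib, Finset.sum_ite_eq', if_pos (Finset.mem_univ _)]
      exact hone
    intro e
    rw [← hdet hτ0 hτt (hMτ.trans hn.symm) e]
    exact ((Finset.sum_eq_sum_iff_of_le hle).1 hsum e (Finset.mem_univ e)).symm
  have hzt : z t = z s₀ + (e₀.1.2 - e₀.1.1) := by
    rw [h.eq_add_sum ht, h.eq_add_sum hs₀, add_assoc]
    simp_rw [hcount]
    simp [add_smul, Finset.sum_add_distrib]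
  obtain ⟨hmem, hproj⟩ := G.add_jump_mem e₀.2 (z := z s₀) (hx.symm.trans he₀x.symm)
  rw [← hzt] at hmem hproj
  refine ⟨hmem, fun f => ?_⟩
  have hb := hbal f
  rw [hproj]
  simp_rw [hcount]
  simp only [Nat.cast_add, add_mul, Finset.sum_add_distrib, Nat.cast_ite, Nat.cast_one,
    Nat.cast_zero, ite_mul, one_mul, zero_mul, Finset.sum_ite_eq', Finset.mem_univ, if_true]
  rw [he₀x]
  linarith

end IsDrivenPath
end PeriodicGraph

/-! ### Long time averages -/

lemma tendsto_div_zero_of_abs_le {f : ℝ → ℝ}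
    (hf : ∀ δ : ℝ, 0 < δ → ∃ C : ℝ, ∀ t, 0 ≤ t → |f t| ≤ δ * t + C) :
    Tendsto (fun t => f t / t) atTop (𝓝 0) := by
  rw [Metric.tendsto_atTop]
  intro η hη
  obtain ⟨C, hC⟩ := hf (η / 2) (by positivity)
  refine ⟨max 1 (2 * |C| / η + 1), fun t ht => ?_⟩
  have ht1 : 1 ≤ t := (le_max_left _ _).trans ht
  have ht2 : 2 * |C| / η < t := by linarith [(le_max_right 1 (2 * |C| / η + 1)).trans ht]
  have ht0 : 0 < t := by linarith
  rw [div_lt_iff₀ hη] at ht2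
  rw [Real.dist_eq, sub_zero, abs_div, abs_of_pos ht0, div_lt_iff₀ ht0]
  linarith [hC t ht0.le, le_abs_self C]

/-- The parabolic rescaling of a path with asymptotic velocity `U` converges uniformly on compact
subintervals of the open half-line. -/
lemma tendsto_iSup_rescaled {E : Type*} [NormedAddCommGroup E] [NormedSpace ℝ E] {z : ℝ → E}
    {U : E} (h : Tendsto (fun t : ℝ => t⁻¹ • z t) atTop (𝓝 U)) {t₀ T : ℝ} (ht₀ : 0 < t₀)
    (hT : t₀ < T) :
    Tendsto (fun ε : ℝ => ⨆ t ∈ Set.Icc t₀ T, ‖ε ^ 2 • z (t / ε ^ 2) - t • U‖ₑ)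
      (𝓝[>] 0) (𝓝 0) := by
  have hTpos : 0 < T := ht₀.trans hT
  rw [ENNReal.tendsto_nhds_zero]
  intro η hη
  obtain ⟨δ, hδ0, hδη⟩ := ENNReal.lt_iff_exists_nnreal_btwn.1 hη
  have hδ : (0 : ℝ) < δ := by exact_mod_cast hδ0
  obtain ⟨S, hS⟩ := Metric.tendsto_atTop.1 h (δ / T) (by positivity)
  have hsmall : ∀ᶠ ε : ℝ in 𝓝[>] 0, ε ^ 2 * S < t₀ := by
    have hc : Continuous fun ε : ℝ => ε ^ 2 * S := by fun_prop
    have := (hc.tendsto 0).mono_left (nhdsWithin_le_nhds (s := Set.Ioi 0))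
    exact this.eventually_lt_const (by simpa using ht₀)
  filter_upwards [hsmall, self_mem_nhdsWithin] with ε hε hε0
  have hε2 : 0 < ε ^ 2 := pow_pos hε0 2
  refine iSup₂_le fun t ht => le_trans ?_ hδη.le
  have htpos : 0 < t := ht₀.trans_le ht.1
  have hd := hS (t / ε ^ 2) (by rw [ge_iff_le, le_div_iff₀ hε2]; linarith [ht.1])
  have e : ε ^ 2 • z (t / ε ^ 2) - t • U = t • ((t / ε ^ 2)⁻¹ • z (t / ε ^ 2) - U) := by
    rw [smul_sub, smul_smul]
    congr 2
    field_simp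
  rw [enorm_le_coe, ← NNReal.coe_le_coe, coe_nnnorm, e, norm_smul, Real.norm_of_nonneg htpos.le]
  rw [dist_eq_norm, lt_div_iff₀ hTpos] at hd
  nlinarith [norm_nonneg ((t / ε ^ 2)⁻¹ • z (t / ε ^ 2) - U), ht.2]

namespace PeriodicGraph

variable {d : ℕ} (G : PeriodicGraph d)

/-- The node of the cell from which an edge of the cell originates. -/
def origin (e : G.cellEdges) : G.cellNodes := ⟨e.1.1, G.fst_mem_cellNodes e.2⟩

open Classical in
lemma sum_smul_sum_origin {E : Type*} [AddCommGroup E] [Module ℝ E] (a : G.cellNodes → ℝ)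
    (g : Space d × Space d → E) :
    ∑ x, a x • ∑ e ∈ G.cellEdges with e.1 = x.1, g e =
      ∑ e : G.cellEdges, a (G.origin e) • g e.1 := by
  rw [← Finset.sum_fiberwise (s := Finset.univ) (g := G.origin)]
  refine Finset.sum_congr rfl fun x _ => ?_
  rw [Finset.smul_sum, Finset.sum_filter, ← Finset.sum_coe_sort, Finset.sum_filter]
  refine Finset.sum_congr rfl fun e _ => ?_
  by_cases he : G.origin e = x
  · rw [if_pos he, if_pos (by rw [← he]; rfl), he]
  · rw [if_neg he, if_neg fun h : e.1.1 = x.1 => he (Subtype.ext h)]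

namespace IsDrivenPath

variable {G} {r : G.cellEdges → ℝ≥0 → ℕ} {z₀ : Space d} {z : ℝ → Space d}
  (h : G.IsDrivenPath r z₀ z)
  (hr : ∀ e, ∀ δ : ℝ, 0 < δ → ∃ C : ℝ, ∀ u : ℝ≥0, |(r e u : ℝ) - u| ≤ δ * u + C)

include h hr

/-- The number of jumps along `e` is asymptotic to the internal time of `e`. -/
lemma tendsto_jumpCount_sub (e : G.cellEdges) :
    Tendsto (fun t => (G.jumpCount r z e t - G.rate e.1 * occupationTime z e.1.1 t) / t)
      atTop (𝓝 0) := by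
  refine tendsto_div_zero_of_abs_le fun δ hδ => ?_
  have hrate := G.rate_pos_of_mem e.2
  obtain ⟨C, hC⟩ := hr e (δ / G.rate e.1) (by positivity)
  refine ⟨C, fun t ht => ?_⟩
  have h1 := hC ((G.rate e.1).toNNReal * (occupationTime z e.1.1 t).toNNReal)
  have h2 := occupationTime_le h.right_continuous e.1.1 ht
  rw [NNReal.coe_mul, Real.coe_toNNReal _ hrate.le,
    Real.coe_toNNReal _ (occupationTime_nonneg h.right_continuous e.1.1 ht)] at h1
  refine h1.trans ?_
  rw [← mul_assoc, div_mul_cancel₀ _ hrate.ne']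
  gcongr

/-- The flow balance kills the range of the rate matrix in the long run. -/
lemma tendsto_sum_occupationTime_mul_mulVec (hz₀ : z₀ ∈ G.nodes) (f : G.cellNodes → ℝ) :
    Tendsto (fun t => ∑ x : G.cellNodes, occupationTime z x.1 t / t * G.rateMatrix.mulVec f x)
      atTop (𝓝 0) := by
  classical
  let F : Space d → ℝ := fun w => if h : w ∈ G.cellNodes then f ⟨w, h⟩ else 0
  have hF : f = fun w : G.cellNodes => F w.1 := funext fun w => by simp [F]
  have hbdd : Tendsto (fun t => (F (projCell (z t)) - F (projCell z₀)) / t) atTop (𝓝 0) := by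
    refine tendsto_div_zero_of_abs_le fun δ hδ =>
      ⟨∑ x ∈ G.cellNodes, |F x| + |F (projCell z₀)|, fun t ht => ?_⟩
    have h1 := Finset.single_le_sum (f := fun x => |F x|) (fun x _ => abs_nonneg (F x))
      (G.projCell_mem_cellNodes (h.mem_nodes_and_balance hz₀ ht).1)
    have h2 := abs_sub (F (projCell (z t))) (F (projCell z₀))
    have h3 : 0 ≤ δ * t := by positivity
    linarith
  have herr : Tendsto (fun t => ∑ e : G.cellEdges,
      (G.jumpCount r z e t - G.rate e.1 * occupationTime z e.1.1 t) / t *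
        (F (projCell e.1.2) - F e.1.1)) atTop (𝓝 0) := by
    simpa using tendsto_finsetSum Finset.univ fun e _ =>
      (h.tendsto_jumpCount_sub hr e).mul_const (F (projCell e.1.2) - F e.1.1)
  have hlim := hbdd.sub herr
  rw [sub_zero] at hlim
  refine hlim.congr' ?_
  filter_upwards [eventually_gt_atTop 0] with t ht
  have hbal := (h.mem_nodes_and_balance hz₀ ht.le).2 F
  rw [hF]
  simp_rw [G.rateMatrix_mulVec_apply F]
  have := G.sum_smul_sum_origin (fun x => occupationTime z x.1 t / t)
    (fun e => G.rate e * (F (projCell e.2) - F e.1))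
  simp only [smul_eq_mul] at this
  rw [this, hbal, add_sub_cancel_left, Finset.sum_div, ← Finset.sum_sub_distrib]
  refine Finset.sum_congr rfl fun e _ => ?_
  simp only [origin]
  ring

/-- The ergodic theorem for the projected walk: the proportion of time spent at `y` converges to the
stationary probability of `y`. -/
lemma tendsto_occupationTime_div (hz₀ : z₀ ∈ G.nodes) {π : G.cellNodes → ℝ}
    (hπ : G.IsStationary π) (y : G.cellNodes) :
    Tendsto (fun t => occupationTime z y.1 t / t) atTop (𝓝 (π y)) := by
  classical
  -- the corrector turns the fluctuation of the occupation time into a flow balance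
  obtain ⟨f, hf⟩ := G.exists_mulVec_eq hπ (g := fun x => (if x = y then 1 else 0) - π y) (by
    simp only [mul_sub, mul_ite, mul_one, mul_zero, Finset.sum_sub_distrib, ← Finset.sum_mul,
      hπ.sum_eq_one, Finset.sum_ite_eq', Finset.mem_univ, if_true, one_mul, sub_self])
  have hlim := (h.tendsto_sum_occupationTime_mul_mulVec hr hz₀ f).add_const (π y)
  rw [zero_add] at hlim
  refine hlim.congr' ?_
  filter_upwards [eventually_gt_atTop 0] with t ht
  have hsum := sum_occupationTime h.right_continuous (S := G.cellNodes)
    (fun s hs => G.projCell_mem_cellNodes (h.mem_nodes_and_balance hz₀ hs).1) ht.le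
  rw [← Finset.sum_coe_sort] at hsum
  simp only [hf, mul_sub, Finset.sum_sub_distrib, ← Finset.sum_mul, ← Finset.sum_div, hsum,
    div_self ht.ne']
  simp

/-- The law of large numbers for the position of the walk. -/
lemma tendsto_inv_smul (hz₀ : z₀ ∈ G.nodes) {π : G.cellNodes → ℝ} (hπ : G.IsStationary π) :
    Tendsto (fun t : ℝ => t⁻¹ • z t) atTop (𝓝 (G.longRunDrift π)) := by
  have hU : G.longRunDrift π =
      (0 : ℝ) • z₀ + ∑ e : G.cellEdges, (G.rate e.1 * π (G.origin e)) • (e.1.2 - e.1.1) := by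
    simp_rw [longRunDrift, drift]
    rw [G.sum_smul_sum_origin π fun e => G.rate e • (e.2 - e.1), zero_smul, zero_add]
    simp_rw [smul_smul, mul_comm]
  have hcount : ∀ e, Tendsto (fun t => G.jumpCount r z e t / t) atTop
      (𝓝 (G.rate e.1 * π (G.origin e))) := fun e => by
    have := (h.tendsto_jumpCount_sub hr e).add
      ((h.tendsto_occupationTime_div hr hz₀ hπ (G.origin e)).const_mul (G.rate e.1))
    rw [zero_add] at this
    refine this.congr fun t => ?_
    simp only [origin]
    ring
  rw [hU]
  refine Tendsto.congr' ?_ ((tendsto_inv_atTop_zero.smul_const z₀).add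
    (tendsto_finsetSum Finset.univ fun e _ => (hcount e).smul_const (e.1.2 - e.1.1)))
  filter_upwards [eventually_ge_atTop 0] with t ht
  rw [h.eq_add_sum ht, smul_add, Finset.smul_sum]
  simp_rw [smul_smul, div_eq_inv_mul]

end IsDrivenPath

/-- Almost every realisation of the walk is a driven path. -/
lemma IsRandomWalk.ae_isDrivenPath {G : PeriodicGraph d} {Ω : Type*} [MeasurableSpace Ω]
    {P : Measure Ω} [IsProbabilityMeasure P] {R : G.cellEdges → ℝ≥0 → Ω → ℕ}
    (hR : ∀ e, IsUnitPoissonProcess P (R e))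
    (hindep : iIndepFun (fun e ω (t : ℝ≥0) => R e t ω) P)
    {z₀ : Space d} {Z : ℝ → Ω → Space d} (hZ : G.IsRandomWalk P R z₀ Z) :
    ∀ᵐ ω ∂P, G.IsDrivenPath (fun e t => R e t ω) z₀ (fun t => Z t ω) := by
  filter_upwards [ae_all_iff.2 fun e => (hR e).mono, ae_all_iff.2 fun e => (hR e).zero,
    ae_all_iff.2 fun e => (hR e).right_continuous, hZ.right_continuous, hZ.time_change,
    IsUnitPoissonProcess.ae_sum_le_sum_add_one hR hindep fun e => (G.rate e.1).toNNReal]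
    with ω hmono hzero hrc hZrc htc hsimple
  refine ⟨hmono, hzero, hrc, hsimple, hZrc, fun t ht => ?_⟩
  rw [htc t ht]
  simp_rw [← Real.toNNReal_mul (G.rate_pos_of_mem (Subtype.prop _)).le]
  rfl

end PeriodicGraph

theorem lemma3p2 {d : ℕ} (G : PeriodicGraph d)
    {Ω : Type*} [MeasurableSpace Ω] (P : Measure Ω) [IsProbabilityMeasure P]
    (R : G.cellEdges → ℝ≥0 → Ω → ℕ)
    (hR : ∀ e, IsUnitPoissonProcess P (R e))
    (hindep : iIndepFun (fun e ω (t : ℝ≥0) => R e t ω) P)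
    (z₀ : Space d) (hz₀ : z₀ ∈ G.nodes)
    (Z : ℝ → Ω → Space d) (hZ : G.IsRandomWalk P R z₀ Z)
    (π : G.cellNodes → ℝ) (hπ : G.IsStationary π)
    (t₀ T : ℝ) (ht₀ : 0 < t₀) (hT : t₀ < T) :
    ∀ᵐ ω ∂P, Tendsto
      (fun ε : ℝ => ⨆ t ∈ Set.Icc t₀ T,
        ‖ε ^ 2 • Z (t / ε ^ 2) ω - t • G.longRunDrift π‖ₑ)
      (𝓝[>] 0) (𝓝 0) := by
  filter_upwards [hZ.ae_isDrivenPath hR hindep, ae_all_iff.2 fun e => (hR e).ae_abs_sub_le]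
    with ω hpath hlln
  exact tendsto_iSup_rescaled (hpath.tendsto_inv_smul hlln hz₀ hπ) ht₀ hT

end
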